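/- A continuous map $p\colon Y\to X$ is a \emph{semicovering} if it is a local homeomorphism and, for every $y\in Y$, composition with $p$ gives homeomorphisms $(\mathcal{P}Y)_y\to(\mathcal{P}X)_{p(y)}$ and $(\Phi Y)_y\to(\Phi X)_{p(y)}$. Here $(\mathcal{P}X)_x$ is the space of paths $\alpha\colon[0,1]\to X$ with $\alpha(0)=x$, and $(\Phi X)_x$ is the space of continuous maps $\Delta_2=\{(s,t)\in[0,1]^2 : s+t\le 1\}\to X$ that are constantly $x$ on the edge $\{s=0\}$, both with the compact-open topology. Let $\mathbf{SCov}(X)$ be the category whose objects are the semicoverings of $X$ and whose morphisms are the continuous maps over $X$, and let $\mathbf{SCov}_0(X)$ be its full subcategory of semicoverings with non-empty, path connected total space. Let $\mathbf{Cov}(X)$ and $\mathbf{Cov}_0(X)$ be the corresponding categories of covering maps $Y\to X$ (the empty covering $\emptyset\to X$ is allowed in $\mathbf{Cov}(X)$) and of covering maps with non-empty, path connected total space. Let $X$ be a (non-empty) path connected, locally path connected and semilocally simply connected space, where the last condition means that every $x\in X$ has a neighborhood $U$ such that every loop at $x$ in $U$ is null-homotopic in $X$ relative to its endpoints. Then every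 semicovering of $X$ is a covering map, and $\mathbf{Cov}(X)=\mathbf{SCov}(X)$ and $\mathbf{Cov}_0(X)=\mathbf{SCov}_0(X)$ as full subcategories of the category of spaces over $X$. -/

import Mathlib

universe u v

open Topology unitInterval CategoryTheory

namespace Semicovering

/-- The path space `(𝒫X)_x` of paths `I → X` starting at `x`, topologized as a subspace of `C(I, X)`
with the compact-open topology. -/
abbrev PathsFrom {X : Type u} [TopologicalSpace X] (x : X) : Type u :=
  {α : C(I, X) // α 0 = x}

/-- The 2-simplex `Δ₂ = {(s, t) ∈ I² | s + t ≤ 1}`. -/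
abbrev Simplex2 : Type := {q : I × I // (q.1 : ℝ) + (q.2 : ℝ) ≤ 1}

/-- The space `(ΦX)_x` of maps `Δ₂ → X` that send the edge `s = 0` (the edge opposite to the
vertex `(1, 0)`) to `x`, topologized as a subspace of `C(Δ₂, X)` with the compact-open topology.
Its elements are the endpoint-preserving homotopies of paths starting at `x`. -/
abbrev HomotopiesFrom {X : Type u} [TopologicalSpace X] (x : X) : Type u :=
  {φ : C(Simplex2, X) // ∀ d : Simplex2, d.1.1 = 0 → φ d = x}

section

variable {Y : Type v} {X : Type u} [TopologicalSpace Y] [TopologicalSpace X]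

/-- The map `(𝒫Y)_y → (𝒫X)_{p y}`, `α ↦ p ∘ α`. -/
def mapPathsFrom (p : C(Y, X)) (y : Y) (α : PathsFrom y) : PathsFrom (p y) :=
  ⟨p.comp α.1, by simp [α.2]⟩

/-- The map `(ΦY)_y → (ΦX)_{p y}`, `φ ↦ p ∘ φ`. -/
def mapHomotopiesFrom (p : C(Y, X)) (y : Y) (φ : HomotopiesFrom y) : HomotopiesFrom (p y) :=
  ⟨p.comp φ.1, fun d hd => by simp [φ.2 d hd]⟩

/-- `p` has continuous lifting of paths. -/
def HasContinuousPathLifting (p : C(Y, X)) : Prop :=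
  ∀ y : Y, IsHomeomorph (mapPathsFrom p y)

/-- `p` has continuous lifting of homotopies. -/
def HasContinuousHomotopyLifting (p : C(Y, X)) : Prop :=
  ∀ y : Y, IsHomeomorph (mapHomotopiesFrom p y)

/-- A semicovering map is a local homeomorphism with continuous lifting of paths and of
homotopies. -/
structure IsSemicovering (p : C(Y, X)) : Prop where
  isLocalHomeomorph : IsLocalHomeomorph p
  pathLifting : HasContinuousPathLifting p
  homotopyLifting : HasContinuousHomotopyLifting p

end

/-- `X` is semilocally simply connected (semilocally 1-connected): every point `x` has a
neighborhood `U` such that every loop at `x` in `U` is null-homotopic in `X` (rel endpoints), that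
is, `π₁(U, x) → π₁(X, x)` is trivial. -/
def SemilocallySimplyConnected (X : Type u) [TopologicalSpace X] : Prop :=
  ∀ x : X, ∃ U ∈ 𝓝 x, ∀ γ : Path x x, (∀ t, γ t ∈ U) → γ.Homotopic (Path.refl x)

/-- `SCov X`: the category of semicoverings of `X`, as a full subcategory of the category of spaces
over `X` (a full subcategory is given by its objects; morphisms are the continuous maps over
`X`). -/
def SCov (X : Type u) [TopologicalSpace X] : ObjectProperty (Over (TopCat.of X)) :=
  fun p => IsSemicovering (p.hom.hom : C(p.left, X))

/-- `Cov X`: the category of coverings of `X`, as a full subcategory of the category of spaces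
over `X`. Empty fibers are allowed, so the empty covering `∅ → X` is included. -/
def Cov (X : Type u) [TopologicalSpace X] : ObjectProperty (Over (TopCat.of X)) :=
  fun p => IsCoveringMap (p.hom.hom : C(p.left, X))

/-- `SCov₀ X`: the full subcategory of connected semicoverings, those whose total space is
non-empty and path connected. -/
def SCov₀ (X : Type u) [TopologicalSpace X] : ObjectProperty (Over (TopCat.of X)) :=
  fun p => SCov X p ∧ PathConnectedSpace p.left

/-- `Cov₀ X`: the full subcategory of connected coverings, those whose total space is
non-empty and path connected. -/
def Cov₀ (X : Type u) [TopologicalSpace X] : ObjectProperty (Over (TopCat.of X)) :=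
  fun p => Cov X p ∧ PathConnectedSpace p.left

end Semicovering

namespace Semicovering

section

variable {Y : Type v} {X : Type u} [TopologicalSpace Y] [TopologicalSpace X] {p : C(Y, X)}

/-! ### Coverings are semicoverings -/

/-! A covering lifts homotopies over any parameter space. Taking the path space, or the space of
simplices times `I`, as parameters makes lifting a continuous inverse of composition with `p`.
Conversely, let loops at `x` in a path connected open `V` die in the whole space. Lifts from a fixed
fibre point of paths in `V` then have endpoints depending only on the endpoints below
(`IsSemicovering.apply_one_eq_of_homotopic`). So each fibre point extends to a section over `V`, and
these sections trivialise `p` there. -/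

theorem isHomeomorph_mapPathsFrom_of_isCoveringMap (hp : IsCoveringMap p) (y : Y) :
    IsHomeomorph (mapPathsFrom p y) := by
  let H : C(I × PathsFrom (p y), X) := ⟨fun q => q.2.1 q.1, by fun_prop⟩
  let L : C(I × PathsFrom (p y), Y) := hp.liftHomotopy H (.const _ y) fun α => α.2
  have L_zero (α) : L (0, α) = y := hp.liftHomotopy_zero H (.const _ y) _ α
  have L_lifts (t) (α : PathsFrom (p y)) : p (L (t, α)) = α.1 t :=
    congr_fun (hp.liftHomotopy_lifts H (.const _ y) _) (t, α)
  refine isHomeomorph_iff_exists_inverse.mpr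
    ⟨((ContinuousMap.continuous_postcomp p).comp continuous_subtype_val).subtype_mk _,
      fun α => ⟨⟨fun t => L (t, α), by fun_prop⟩, L_zero α⟩, fun β => ?_, fun α => ?_, ?_⟩
  · refine Subtype.ext <| DFunLike.coe_injective ?_
    refine hp.eq_of_comp_eq (by fun_prop) β.1.continuous ?_ 0 ((L_zero _).trans β.2.symm)
    exact funext fun t => L_lifts t (mapPathsFrom p y β)
  · exact Subtype.ext <| ContinuousMap.ext fun t => L_lifts t α
  · refine Continuous.subtype_mk (ContinuousMap.continuous_of_continuous_uncurry _ ?_) _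
    exact L.continuous.comp continuous_swap

instance : CompactSpace Simplex2 :=
  isCompact_iff_compactSpace.mp
    (isClosed_le (f := fun q : I × I => (q.1 : ℝ) + q.2) (by fun_prop) continuous_const).isCompact

/-- The horizontal retraction of the unit square onto `Simplex2`. -/
def squareToSimplex2 : C(I × I, Simplex2) where
  toFun q := ⟨(min q.1 (σ q.2), q.2), by
    have : ((min q.1 (σ q.2) : I) : ℝ) ≤ (σ q.2 : I) := min_le_right _ _
    rw [unitInterval.coe_symm_eq] at this
    linarith⟩
  continuous_toFun := by fun_prop

theorem squareToSimplex2_zero (t : I) : (squareToSimplex2 (0, t)).1.1 = 0 :=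
  min_eq_left (unitInterval.nonneg _)

theorem squareToSimplex2_apply (d : Simplex2) : squareToSimplex2 d.1 = d := by
  refine Subtype.ext (Prod.ext (min_eq_left ?_) rfl)
  rw [← Subtype.coe_le_coe, unitInterval.coe_symm_eq]
  linarith [d.2]

theorem isHomeomorph_mapHomotopiesFrom_of_isCoveringMap (hp : IsCoveringMap p) (y : Y) :
    IsHomeomorph (mapHomotopiesFrom p y) := by
  -- Each horizontal row of the simplex is lifted as a path from the edge `s = 0`; the retraction
  -- prolongs all rows to length one.
  let H : C(I × (HomotopiesFrom (p y) × I), X) :=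
    ⟨fun q => q.2.1.1 (squareToSimplex2 (q.1, q.2.2)),
      Continuous.eval (continuous_subtype_val.comp (by fun_prop)) (by fun_prop)⟩
  have H_zero (a) : H (0, a) = p (ContinuousMap.const _ y a) :=
    a.1.2 _ (squareToSimplex2_zero a.2)
  let L : C(I × (HomotopiesFrom (p y) × I), Y) := hp.liftHomotopy H (.const _ y) H_zero
  have L_zero (a) : L (0, a) = y := hp.liftHomotopy_zero H (.const _ y) H_zero a
  have L_lifts (s) (φ : HomotopiesFrom (p y)) (t) :
      p (L (s, φ, t)) = φ.1 (squareToSimplex2 (s, t)) :=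
    congr_fun (hp.liftHomotopy_lifts H (.const _ y) H_zero) (s, φ, t)
  refine isHomeomorph_iff_exists_inverse.mpr
    ⟨((ContinuousMap.continuous_postcomp p).comp continuous_subtype_val).subtype_mk _,
      fun φ => ⟨⟨fun d => L (d.1.1, φ, d.1.2), by fun_prop⟩, fun d hd => ?_⟩,
      fun ψ => ?_, fun φ => ?_, ?_⟩
  · simp [hd, L_zero]
  · refine Subtype.ext <| ContinuousMap.ext fun d => ?_
    have key : (fun s => L (s, mapHomotopiesFrom p y ψ, d.1.2)) =
        fun s => ψ.1 (squareToSimplex2 (s, d.1.2)) := by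
      refine hp.eq_of_comp_eq (by fun_prop) (by fun_prop) ?_ 0
        ((L_zero _).trans (ψ.2 _ (squareToSimplex2_zero _)).symm)
      exact funext fun s => L_lifts s (mapHomotopiesFrom p y ψ) d.1.2
    exact (congr_fun key d.1.1).trans (congrArg ψ.1 (squareToSimplex2_apply d))
  · exact Subtype.ext <| ContinuousMap.ext fun d =>
      (L_lifts d.1.1 φ d.1.2).trans (congrArg φ.1 (squareToSimplex2_apply d))
  · refine Continuous.subtype_mk (ContinuousMap.continuous_of_continuous_uncurry _ ?_) _
    exact L.continuous.comp (f := fun q : HomotopiesFrom (p y) × Simplex2 =>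
      (q.2.1.1, q.1, q.2.1.2)) (by fun_prop)

theorem isSemicovering_of_isCoveringMap (hp : IsCoveringMap p) : IsSemicovering p where
  isLocalHomeomorph := hp.isLocalHomeomorph
  pathLifting := isHomeomorph_mapPathsFrom_of_isCoveringMap hp
  homotopyLifting := isHomeomorph_mapHomotopiesFrom_of_isCoveringMap hp

/-! ### Lifting paths and homotopies through a semicovering -/

theorem HasContinuousPathLifting.exists_lift (hp : HasContinuousPathLifting p) (γ : C(I, X))
    (y : Y) (h : γ 0 = p y) : ∃ Γ : C(I, Y), Γ 0 = y ∧ p ∘ Γ = γ := by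
  obtain ⟨Γ, hΓ⟩ := (hp y).surjective ⟨γ, h⟩
  exact ⟨Γ.1, Γ.2, congrArg (fun α : PathsFrom (p y) => (α.1 : I → X)) hΓ⟩

theorem HasContinuousPathLifting.eq_of_comp_eq (hp : HasContinuousPathLifting p) {Γ Γ' : C(I, Y)}
    (h0 : Γ 0 = Γ' 0) (h : p ∘ Γ = p ∘ Γ') : Γ = Γ' := by
  have := (hp (Γ' 0)).injective (a₁ := ⟨Γ, h0⟩) (a₂ := ⟨Γ', rfl⟩)
    (Subtype.ext (DFunLike.coe_injective h))
  exact congrArg Subtype.val this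

/-- Reversing time turns the common endpoint into a common start. -/
theorem HasContinuousPathLifting.eq_zero_of_comp_eq (hp : HasContinuousPathLifting p)
    {Γ Γ' : C(I, Y)} (h1 : Γ 1 = Γ' 1) (h : p ∘ Γ = p ∘ Γ') : Γ 0 = Γ' 0 := by
  let r : C(I, I) := ⟨σ, unitInterval.continuous_symm⟩
  have := hp.eq_of_comp_eq (Γ := Γ.comp r) (Γ' := Γ'.comp r) (by simpa [r] using h1)
    (funext fun t => congr_fun h (σ t))
  simpa [r] using DFunLike.congr_fun this 1

/-- Doubling a parameter, truncated at `1`. -/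
noncomputable def double : C(I, I) := ⟨fun t => Set.projIcc 0 1 zero_le_one (2 * (t : ℝ)), by fun_prop⟩

theorem double_zero : double 0 = 0 := by simp [double]

theorem double_of_le {t : I} (h : (1 / 2 : ℝ) ≤ t) : double t = 1 :=
  Set.projIcc_of_right_le zero_le_one (by linarith)

theorem double_one : double 1 = 1 := double_of_le (by norm_num)

/-- Lifts of homotopic paths that start at the same point end at the same point. -/
theorem IsSemicovering.apply_one_eq_of_homotopic (hp : IsSemicovering p) {x x' : X}
    {γ γ' : Path x x'} (h : γ.Homotopic γ') {Γ Γ' : C(I, Y)} (h0 : Γ 0 = Γ' 0)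
    (hΓ : p ∘ Γ = γ) (hΓ' : p ∘ Γ' = γ') : Γ 1 = Γ' 1 := by
  obtain ⟨F⟩ := h
  have hx : p (Γ 0) = x := (congr_fun hΓ 0).trans γ.source
  -- With both parameters doubled, the edge `t = 0` carries `γ` and the hypotenuse `γ'`: on the
  -- latter, either the homotopy is finished or the path is already at `x'`. Both edges end at the
  -- vertex `(1, 0)`.
  let φ : HomotopiesFrom (p (Γ 0)) :=
    ⟨⟨fun d => F (double d.1.2, double d.1.1), by fun_prop⟩, fun d hd => by
      simp [hd, double_zero, hx]⟩
  obtain ⟨ψ, hψ⟩ := (hp.homotopyLifting (Γ 0)).surjective φ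
  have hψ' (d : Simplex2) : p (ψ.1 d) = F (double d.1.2, double d.1.1) :=
    congrArg (fun α : HomotopiesFrom (p (Γ 0)) => α.1 d) hψ
  let base : C(I, Simplex2) := ⟨fun s => ⟨(s, 0), by simpa using s.2.2⟩, by fun_prop⟩
  let hyp : C(I, Simplex2) := ⟨fun s => ⟨(s, σ s), by simp⟩, by fun_prop⟩
  have e : Γ.comp double = ψ.1.comp base := by
    refine hp.pathLifting.eq_of_comp_eq ?_ (funext fun s => ?_)
    · simpa [double_zero] using (ψ.2 (base 0) rfl).symm
    · refine (congr_fun hΓ (double s)).trans ?_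
      simp [hψ', base, double_zero]
  have e' : Γ'.comp double = ψ.1.comp hyp := by
    refine hp.pathLifting.eq_of_comp_eq ?_ (funext fun s => ?_)
    · simpa [double_zero, ← h0] using (ψ.2 (hyp 0) rfl).symm
    · refine (congr_fun hΓ' (double s)).trans ?_
      simp only [Function.comp_apply, ContinuousMap.comp_apply, hψ', hyp, ContinuousMap.coe_mk]
      rcases le_total (1 / 2 : ℝ) s with hs | hs
      · simp [double_of_le hs]
      · rw [double_of_le (t := σ s) (by rw [unitInterval.coe_symm_eq]; linarith)]
        simp
  have e1 := DFunLike.congr_fun e 1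
  have e1' := DFunLike.congr_fun e' 1
  simp only [ContinuousMap.comp_apply, double_one] at e1 e1'
  rw [e1, e1']
  exact congrArg ψ.1 (Subtype.ext (by simp [base, hyp]))

/-! ### Semicoverings of semilocally simply connected spaces are coverings -/

theorem homotopic_of_trans_symm {x x' : X} {γ γ' : Path x x'}
    (h : (γ.trans γ'.symm).Homotopic (.refl x)) : γ.Homotopic γ' := by
  rw [← Path.Homotopic.Quotient.eq] at h ⊢
  have := congrArg (fun q => q.trans (.mk γ')) h
  simpa using this

/-- A path connected open set in which loops at `x` are null-homotopic in the whole space is evenly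
covered by every semicovering. -/
theorem IsSemicovering.isEvenlyCovered [LocallyPathConnectedSpace X] (hp : IsSemicovering p)
    {x : X} {V : Set X} (hV : IsOpen V) (hVc : IsPathConnected V) (hxV : x ∈ V)
    (hloop : ∀ γ : Path x x, (∀ t, γ t ∈ V) → γ.Homotopic (Path.refl x)) :
    IsEvenlyCovered p x (p ⁻¹' {x}) := by
  have := isPathConnected_iff_pathConnectedSpace.mp hVc
  have := hV.locallyPathConnectedSpace
  have hdisc : DiscreteTopology (p ⁻¹' {x}) := by
    have : Subsingleton (p '' (p ⁻¹' {x})) :=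
      (Set.subsingleton_singleton.anti (Set.image_preimage_subset _ _)).coe_sort
    exact hp.isLocalHomeomorph.isLocalHomeomorphOn.discreteTopology_of_image
  let incl : C(V, X) := ⟨Subtype.val, continuous_subtype_val⟩
  have hsec (y : p ⁻¹' {x}) : ∃ F : C(V, Y), F ⟨x, hxV⟩ = y ∧ p ∘ F = incl := by
    -- Lifting criterion: paths in `V` lift, and two with equal endpoints form a loop in `V`, so
    -- their lifts end together.
    refine (hp.isLocalHomeomorph.existsUnique_continuousMap_lifts incl ⟨x, hxV⟩ y.1 y.2
      (fun γ hγ => ?_) fun γ γ' Γ Γ' hγ hγ' hΓ hΓ' lift lift' h1 => ?_).exists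
    · exact hp.pathLifting.exists_lift (incl.comp γ) y (by simpa [hγ, incl] using y.2.symm)
    · let δ : Path x (γ 1 : X) := ⟨incl.comp γ, by simp [hγ, incl], rfl⟩
      let δ' : Path x (γ 1 : X) := ⟨incl.comp γ', by simp [hγ', incl], by simp [h1, incl]⟩
      refine hp.apply_one_eq_of_homotopic (γ := δ) (γ' := δ') (homotopic_of_trans_symm
        (hloop _ fun t => ?_)) (hΓ.trans hΓ'.symm) lift lift'
      rw [Path.trans_apply]
      split_ifs
      exacts [(γ _).2, (γ' _).2]
  choose s s_base s_lifts using hsec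
  have s_apply (y) (v : V) : p (s y v) = v := congr_fun (s_lifts y) v
  let Φ : V × p ⁻¹' {x} → p ⁻¹' V := fun q => ⟨s q.2 q.1, by simp [s_apply]⟩
  have Φ_cont : Continuous Φ := by
    refine Continuous.subtype_mk (continuous_prod_of_discrete_right.mpr fun y => ?_) _
    exact (s y).continuous
  have Φ_inj : Function.Injective Φ := by
    rintro ⟨v, y⟩ ⟨v', y'⟩ h
    have h : s y v = s y' v' := congrArg Subtype.val h
    obtain rfl : v = v' := Subtype.ext (by rw [← s_apply y v, h, s_apply])
    -- Sections agreeing at `v` agree back along a path to `x`, where their values are `y` and `y'`.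
    let γ := PathConnectedSpace.somePath (⟨x, hxV⟩ : V) v
    have := hp.pathLifting.eq_zero_of_comp_eq (Γ := (s y).comp γ) (Γ' := (s y').comp γ)
      (by simpa using h) (funext fun t => by simp [s_apply])
    simp only [ContinuousMap.comp_apply, ContinuousMap.coe_coe, Path.source, s_base] at this
    rw [Subtype.ext this]
  have Φ_surj : Function.Surjective Φ := by
    rintro ⟨z, hz⟩
    -- The lift from `z` of a path to `x` ends at the fibre point whose section passes through `z`.
    let γ := PathConnectedSpace.somePath (⟨p z, hz⟩ : V) ⟨x, hxV⟩
    obtain ⟨Γ, hΓ0, hΓ⟩ := hp.pathLifting.exists_lift (incl.comp γ) z (by simp [incl])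
    have hy : p (Γ 1) = x := (congr_fun hΓ 1).trans (by simp [incl])
    refine ⟨(⟨p z, hz⟩, ⟨Γ 1, hy⟩), Subtype.ext ?_⟩
    have := hp.pathLifting.eq_zero_of_comp_eq (Γ := (s ⟨Γ 1, hy⟩).comp γ) (Γ' := Γ)
      (by simp [s_base]) (funext fun t => by
        refine Eq.trans ?_ (congr_fun hΓ t).symm
        simp [s_apply, incl])
    simpa [hΓ0] using this
  have Φ_open : IsOpenMap Φ := by
    -- Both `p` and `p ∘ s y`, an open inclusion, are local homeomorphisms, hence so is `s y`.
    have hs (y) : IsOpenMap (s y) :=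
      (IsLocalHomeomorph.of_comp (f := s y) (g := p) (by
        rw [s_lifts]; exact hV.isOpenEmbedding_subtypeVal.isLocalHomeomorph)
        hp.isLocalHomeomorph (s y).continuous).isOpenMap
    intro W hW
    have : Φ '' W = ⋃ y, Subtype.val ⁻¹' (s y '' {v | (v, y) ∈ W}) := by
      ext z
      simp only [Set.mem_image, Prod.exists, Set.mem_iUnion, Set.mem_preimage, Set.mem_ofPred_eq,
        Subtype.ext_iff, Φ]
      exact exists_comm
    rw [this]
    exact isOpen_iUnion fun y => ((hs y) _ (hW.preimage (by fun_prop))).preimage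
      continuous_subtype_val
  let e := (Equiv.ofBijective Φ ⟨Φ_inj, Φ_surj⟩).toHomeomorphOfContinuousOpen Φ_cont Φ_open
  refine ⟨hdisc, V, hxV, hV, hV.preimage p.continuous, e.symm, fun z => ?_⟩
  obtain ⟨q, rfl⟩ := e.surjective z
  rw [e.symm_apply_apply]
  exact (s_apply q.2 q.1).symm

theorem IsSemicovering.isCoveringMap [LocallyPathConnectedSpace X]
    (hX : SemilocallySimplyConnected X) (hp : IsSemicovering p) : IsCoveringMap p := by
  intro x
  obtain ⟨U, hU, hloop⟩ := hX x
  obtain ⟨V, ⟨hV, hxV, hVc⟩, hVU⟩ := (isOpen_isPathConnected_basis x).mem_iff.mp hU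
  exact hp.isEvenlyCovered hV hVc hxV fun γ hγ => hloop γ fun t => hVU (hγ t)

end

end Semicovering

theorem mainTheorem8 (X : Type u) [TopologicalSpace X]
    [PathConnectedSpace X] [LocallyPathConnectedSpace X]
    (hX : Semicovering.SemilocallySimplyConnected X) :
    (∀ (Y : Type v) [TopologicalSpace Y] (p : C(Y, X)),
      Semicovering.IsSemicovering p → IsCoveringMap p) ∧
    Semicovering.Cov X = Semicovering.SCov X ∧
    Semicovering.Cov₀ X = Semicovering.SCov₀ X := by
  have h : Semicovering.Cov X = Semicovering.SCov X := by
    ext p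
    exact ⟨Semicovering.isSemicovering_of_isCoveringMap, fun hp => hp.isCoveringMap hX⟩
  refine ⟨fun Y _ p hp => hp.isCoveringMap hX, h, ?_⟩
  unfold Semicovering.Cov₀ Semicovering.SCov₀
  rw [h]
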